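/- Let $A$ be a noncommutative algebra over $\mathbb{C}$ with a conjugate-linear involution $*$ satisfying $(xy)^*=y^*x^*$, and let $\mathbf{B}=\{b_0=1,b_1,\dots,b_5\}$ be a basis of $A$ with $\mathbf{B}^*=\mathbf{B}$ and $b_ib_j=\sum_k\lambda_{ijk}b_k$, where all $\lambda_{ijk}$ are nonnegative real numbers, $\lambda_{ij0}\neq 0$ if and only if $b_j=b_i^*$, and the coefficients of $b_0$ in $b_ib_i^*$ and in $b_i^*b_i$ are equal and positive. Let $\delta:A\to\mathbb{C}$ be an algebra homomorphism with $\delta(a^*)=\overline{\delta(a)}$ and $\delta_i:=\delta(b_i)>0$, and assume that $\mathbf{B}$ is standard, i.e. $\delta_i$ is the coefficient of $b_0$ in $b_ib_i^*$ for every $i$. Put $n=\sum_i\delta_i$ and let $\tau\left(\sum_i\alpha_ib_i\right)=n\alpha_0$. Write $\tau=\sum_{\psi}m_\psi\psi$, where $\psi$ runs over the irreducible characters of $A$. Assume that $(A,\mathbf{B})$ is non-real bipartite: $b_5=b_4^*$, and there is a one-dimensional character $\phi$ of $A$ with $m_\phi=1$ and $$\ker\phi:=\{b_i\in\mathbf{B}:\phi(b_i)=\delta_i\}=\{b_0,b_4,b_5\}.$$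 Then $(A,\mathbf{B})$ is integral (all $\lambda_{ijk}$ are integers) if and only if there are odd positive integers $\alpha,\gamma,k_1,k_2$ such that $$\delta_1=\alpha\gamma k_1,\quad \delta_2=\alpha\gamma k_2,\quad \delta_3=\alpha^2k_1k_2,\quad \gcd(k_1,k_2)=1,\quad \alpha^2<2\gamma,$$ and $\delta_4$ is an integer that divides each of $$\gamma k_1k_2,\quad \gamma k_1(\alpha\gamma k_1-1),\quad \gamma k_2(\alpha\gamma k_2-1),\quad k_1k_2(\alpha^2k_1k_2-1).$$ -/

import Mathlib

/-! Reality-based algebras and table algebras.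

An algebra with involution over `ℂ` is a type `A` with
`[Ring A] [StarRing A] [Algebra ℂ A] [StarModule ℂ A]`: the star is conjugate-linear,
involutive, and reverses products. A distinguished basis `b_0, …, b_{r-1}` is a
`Module.Basis (Fin r) ℂ A`. -/

open scoped ComplexOrder

namespace RealityBased

variable {A : Type*} [Ring A] [StarRing A] [Algebra ℂ A] {r : ℕ} [NeZero r]

/-- The structure constant `λ_{ijk}`, where `b_i b_j = ∑ k, λ_{ijk} b_k`. -/
noncomputable def structConst (b : Module.Basis (Fin r) ℂ A) (i j k : Fin r) : ℂ :=
  b.repr (b i * b j) k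

/-- The basis `b` makes `A` a reality-based algebra (RBA). -/
structure IsRBABasis (b : Module.Basis (Fin r) ℂ A) : Prop where
  one : b 0 = 1
  real : ∀ i j k, (structConst b i j k).im = 0
  star_mem : ∀ i, star (b i) ∈ Set.range b
  ne_zero_iff : ∀ i j, structConst b i j 0 ≠ 0 ↔ b j = star (b i)
  comm : ∀ i, b.repr (b i * star (b i)) 0 = b.repr (star (b i) * b i) 0
  pos : ∀ i, 0 < b.repr (b i * star (b i)) 0

/-- `δ` is a positive degree map: a one-dimensional representation, compatible with the
involutions, which is positive (in particular real) on the basis. -/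
structure IsPositiveDegreeMap (b : Module.Basis (Fin r) ℂ A) (δ : A →ₐ[ℂ] ℂ) : Prop where
  map_star : ∀ a, δ (star a) = star (δ a)
  pos : ∀ i, 0 < δ (b i)

/-- The basis `b` is standard with respect to `δ`: `δ(b_i) = λ_{ii*0}`. -/
def IsStandard (b : Module.Basis (Fin r) ℂ A) (δ : A →ₐ[ℂ] ℂ) : Prop :=
  ∀ i, δ (b i) = b.repr (b i * star (b i)) 0

/-- `(A, b)` is a table algebra with positive degree map `δ` and standard basis `b`: an RBA
all of whose structure constants are nonnegative real numbers. -/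
structure IsStandardTableAlgebra (b : Module.Basis (Fin r) ℂ A) (δ : A →ₐ[ℂ] ℂ) : Prop where
  rba : IsRBABasis b
  degree : IsPositiveDegreeMap b δ
  standard : IsStandard b δ
  nonneg : ∀ i j k, 0 ≤ structConst b i j k

/-- All structure constants are rational integers. -/
def IsIntegral (b : Module.Basis (Fin r) ℂ A) : Prop :=
  ∀ i j k, ∃ z : ℤ, structConst b i j k = (z : ℂ)

/-- The order `n = ∑ i, δ(b_i)`. -/
noncomputable def order (b : Module.Basis (Fin r) ℂ A) (δ : A →ₐ[ℂ] ℂ) : ℂ :=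
  ∑ i, δ (b i)

/-- The standard feasible trace `τ(∑ i, α_i b_i) = n α_0`. -/
noncomputable def standardTrace (b : Module.Basis (Fin r) ℂ A) (δ : A →ₐ[ℂ] ℂ) : A →ₗ[ℂ] ℂ :=
  order b δ • b.coord 0

/-- The set `Irr(A)` of irreducible characters of `A`: traces of the nonzero
finite-dimensional complex matrix representations without proper nonzero invariant subspace. -/
def irrChars (A : Type*) [Ring A] [Algebra ℂ A] : Set (A →ₗ[ℂ] ℂ) :=
  {ψ | ∃ (d : ℕ) (ρ : A →ₐ[ℂ] Matrix (Fin d) (Fin d) ℂ), 0 < d ∧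
    (∀ W : Submodule ℂ (Fin d → ℂ),
      (∀ a, ∀ w ∈ W, (ρ a).mulVec w ∈ W) → W = ⊥ ∨ W = ⊤) ∧
    ∀ a, ψ a = (ρ a).trace}

/-- `m` gives the multiplicities of the RBA: the coefficients in the expression
`τ = ∑ ψ ∈ Irr(A), m_ψ ψ` of the standard feasible trace. As `τ ≠ 0`, the equation forces the
sum to be a genuine one, with finitely many nonzero terms. -/
def IsMultiplicity (b : Module.Basis (Fin r) ℂ A) (δ : A →ₐ[ℂ] ℂ)
    (m : (A →ₗ[ℂ] ℂ) → ℂ) : Prop :=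
  standardTrace b δ = ∑ᶠ ψ ∈ irrChars A, m ψ • ψ

/-- The kernel of a character `ψ`: the basis elements `b_i` with `ψ(b_i) = δ(b_i) ψ(b_0)`. -/
def charKer (b : Module.Basis (Fin r) ℂ A) (δ : A →ₐ[ℂ] ℂ) (ψ : A →ₗ[ℂ] ℂ) : Set A :=
  {x | x ∈ Set.range b ∧ ψ x = δ x * ψ (b 0)}

/-- A noncommutative rank 6 table algebra `(A, b)` with degree map `δ` and second linear
character `φ` is *non-real bipartite* (with the labelling in which `b_4, b_5 = b_4*` are the two
non-real basis elements) if `m_φ = 1` and `ker φ = {b_0, b_4, b_5}`. -/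
structure IsNonRealBipartite (b : Module.Basis (Fin 6) ℂ A) (δ φ : A →ₐ[ℂ] ℂ) : Prop where
  table : IsStandardTableAlgebra b δ
  noncomm : ∃ x y : A, x * y ≠ y * x
  star_four : star (b 4) = b 5
  mult : ∃ m, IsMultiplicity b δ m ∧ m φ.toLinearMap = 1
  ker : charKer b δ φ.toLinearMap = {b 0, b 4, b 5}

end RealityBased

/-! Everything is read off from the numbers `T i j k`, the coefficient of `b 0` in `b i * b j * b
k`, which are invariant under cyclic shifts. Since `m_φ = 1`, equality holds in `|φ| ≤ δ`, so `f = φ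
/ δ` has modulus 1 on the basis and `T i j k ≠ 0` forces `f i * f j * f k = 1`
(`exists_tripleArray`). This is a grading whose trivial part is `{b 0, b 4, b 5}`. If the star
swapped two of `b 1, b 2, b 3`, cyclicity and row sums would make `T` symmetric and `A` commutative
(`symm_of_swap`). Hence these three are self-adjoint of grade `-1`, and linear relations together
with one associativity identity express `T` through the degrees and a square root `t` of `δ₁δ₂δ₃`
(`exists_isParametrized`). Integrality makes each `δᵢ` odd and each `uᵢ = t / δᵢ` an integer for `i
≤ 3`, with `δ₁ = u₂u₃`, `δ₂ = u₁u₃`, `δ₃ = u₁u₂`; then `α = gcd(u₁, u₂)` and `γ = |u₃|`. The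
divisibility conditions express integrality of the coefficients of `b 4`, once `α`, which is coprime
to `δ₄`, is cancelled. Conversely `t = ±α²γk₁k₂`, and every structure constant is checked from the
explicit `T`. -/

namespace RealityBased

/-! ### Reality-based algebras: trace form, degree bound, multiplicities. -/

section General

variable {A : Type*} [Ring A] [StarRing A] [Algebra ℂ A] {r : ℕ} [NeZero r]
  {b : Module.Basis (Fin r) ℂ A} {δ : A →ₐ[ℂ] ℂ}

set_option linter.unusedSectionVars false

theorem mul_eq_sum_structConst (b : Module.Basis (Fin r) ℂ A) (i j : Fin r) :
    b i * b j = ∑ k, structConst b i j k • b k :=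
  (b.sum_repr (b i * b j)).symm

theorem map_mul_eq_sum (b : Module.Basis (Fin r) ℂ A) (χ : A →ₐ[ℂ] ℂ) (i j : Fin r) :
    χ (b i) * χ (b j) = ∑ k, structConst b i j k * χ (b k) := by
  rw [← map_mul, mul_eq_sum_structConst, map_sum]
  simp

theorem structConst_assoc (b : Module.Basis (Fin r) ℂ A) (i j k m : Fin r) :
    ∑ l, structConst b i j l * structConst b l k m =
      ∑ l, structConst b j k l * structConst b i l m := by
  have h := congrArg (fun a => b.repr a m) (mul_assoc (b i) (b j) (b k))
  simp only [mul_eq_sum_structConst b i j, mul_eq_sum_structConst b j k, Finset.sum_mul,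
    Finset.mul_sum, smul_mul_assoc, mul_smul_comm, map_sum, map_smul,
    Finsupp.coe_finsetSum, Finset.sum_apply, Finsupp.smul_apply, smul_eq_mul] at h
  exact h

theorem IsRBABasis.exists_star (hb : IsRBABasis b) :
    ∃ s : Fin r → Fin r, (∀ i, star (b i) = b (s i)) ∧ Function.Involutive s ∧ s 0 = 0 := by
  choose s hs using hb.star_mem
  have hinj := b.injective
  refine ⟨s, fun i => (hs i).symm, fun i => hinj ?_, hinj ?_⟩
  · rw [hs, hs, star_star]
  · rw [hs, hb.one, star_one]

theorem structConst_star [StarModule ℂ A] (hb : IsRBABasis b) {s : Fin r → Fin r}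
    (hs : ∀ i, star (b i) = b (s i)) (hinv : Function.Involutive s) (i j k : Fin r) :
    structConst b (s j) (s i) (s k) = structConst b i j k := by
  have h : b (s j) * b (s i) = ∑ k, structConst b i j k • b (s k) := by
    rw [← hs, ← hs, ← star_mul, mul_eq_sum_structConst, star_sum]
    refine Finset.sum_congr rfl fun k _ => ?_
    rw [star_smul, hs, Complex.star_def, Complex.conj_eq_iff_im.2 (hb.real i j k)]
  rw [structConst, h]
  simp only [map_sum, map_smul, Finsupp.coe_finsetSum, Finset.sum_apply, Finsupp.smul_apply,
    smul_eq_mul, Module.Basis.repr_self]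
  rw [Finset.sum_eq_single k]
  · simp
  · intro l _ hl
    simp [hinv.injective.ne hl]
  · simp

theorem structConst_zero_right (hb : IsRBABasis b) (hst : IsStandard b δ) {s : Fin r → Fin r}
    (hs : ∀ i, star (b i) = b (s i)) (i j : Fin r) :
    structConst b i j 0 = if j = s i then δ (b i) else 0 := by
  split_ifs with h
  · rw [hst, hs, h, structConst]
  · by_contra h0
    exact h (b.injective (((hb.ne_zero_iff i j).1 h0).trans (hs i)))

theorem degree_star_index (hb : IsRBABasis b) (hst : IsStandard b δ) {s : Fin r → Fin r}
    (hs : ∀ i, star (b i) = b (s i)) (i : Fin r) : δ (b (s i)) = δ (b i) := by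
  rw [hst, hst, ← hs, star_star, ← hb.comm]

/-- Cyclic invariance of the trace form `a ↦ b.repr a 0` on triple products. -/
theorem structConst_cyclic (hb : IsRBABasis b) (hst : IsStandard b δ) {s : Fin r → Fin r}
    (hs : ∀ i, star (b i) = b (s i)) (hinv : Function.Involutive s) (i j k : Fin r) :
    structConst b i j (s k) * δ (b k) = structConst b j k (s i) * δ (b i) := by
  -- At the coefficient of `b 0` each side of associativity collapses to a single term.
  have h := structConst_assoc b i j k 0
  simp only [structConst_zero_right hb hst hs] at h
  rw [Finset.sum_eq_single (s k), Finset.sum_eq_single (s i)] at h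
  · simpa [hinv k, degree_star_index hb hst hs] using h
  · intro l _ hl; simp [hl]
  · simp
  · intro l _ hl
    rw [if_neg, mul_zero]
    rintro rfl
    exact hl (hinv l).symm
  · simp

/-- A Perron–Frobenius argument: choose `j` maximising `‖χ (b j)‖ / ‖δ (b j)‖` and expand `χ (b i *
b j)`. Nonnegativity of the structure constants lets the same expansion for `δ` bound it. -/
theorem norm_map_le_degree (ht : IsStandardTableAlgebra b δ) (χ : A →ₐ[ℂ] ℂ) (i : Fin r) :
    ‖χ (b i)‖ ≤ ‖δ (b i)‖ := by
  have hpos : ∀ k, 0 < ‖δ (b k)‖ := fun k => norm_pos_iff.2 (ht.degree.pos k).ne'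
  obtain ⟨j, -, hj⟩ := Finset.exists_max_image Finset.univ
    (fun k => ‖χ (b k)‖ / ‖δ (b k)‖) Finset.univ_nonempty
  set C := ‖χ (b j)‖ / ‖δ (b j)‖ with hC
  have hle : ∀ k, ‖χ (b k)‖ ≤ C * ‖δ (b k)‖ := fun k =>
    (div_le_iff₀ (hpos k)).1 (hj k (Finset.mem_univ k))
  have hCpos : 0 < C := by
    have h0 := hle 0
    rw [ht.rba.one, map_one, map_one, norm_one, mul_one] at h0
    linarith
  have hχ : ‖χ (b j)‖ = C * ‖δ (b j)‖ := (div_eq_iff (hpos j).ne').1 hC.symm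
  have hδ : ‖δ (b i)‖ * ‖δ (b j)‖ = ∑ k, ‖structConst b i j k‖ * ‖δ (b k)‖ := by
    have h1 := map_mul_eq_sum b δ i j
    have h2 : ∀ z : ℂ, 0 ≤ z → z = (‖z‖ : ℂ) := fun z hz => Complex.eq_coe_norm_of_nonneg hz
    rw [h2 _ (ht.degree.pos i).le, h2 _ (ht.degree.pos j).le] at h1
    have h3 : ∀ k, structConst b i j k * δ (b k) =
        ((‖structConst b i j k‖ * ‖δ (b k)‖ : ℝ) : ℂ) := fun k => by
      rw [Complex.ofReal_mul, ← h2 _ (ht.nonneg i j k), ← h2 _ (ht.degree.pos k).le]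
    simp only [h3] at h1
    exact_mod_cast h1
  have key : ‖χ (b i)‖ * (C * ‖δ (b j)‖) ≤ ‖δ (b i)‖ * (C * ‖δ (b j)‖) := by
    calc ‖χ (b i)‖ * (C * ‖δ (b j)‖) = ‖∑ k, structConst b i j k * χ (b k)‖ := by
          rw [← hχ, ← norm_mul, map_mul_eq_sum]
      _ ≤ ∑ k, ‖structConst b i j k‖ * (C * ‖δ (b k)‖) := by
          refine (norm_sum_le _ _).trans (Finset.sum_le_sum fun k _ => ?_)
          rw [norm_mul]
          exact mul_le_mul_of_nonneg_left (hle k) (norm_nonneg _)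
      _ = ‖δ (b i)‖ * (C * ‖δ (b j)‖) := by
          rw [mul_left_comm, hδ, Finset.mul_sum]
          exact Finset.sum_congr rfl fun k _ => by ring
  exact le_of_mul_le_mul_right key (mul_pos hCpos (hpos j))

/-- An irreducible character other than the linear character `φ` vanishes on every element
on which `A` acts from the left through `φ`. -/
theorem irrChar_apply_eq_zero {A : Type*} [Ring A] [Algebra ℂ A] {φ : A →ₐ[ℂ] ℂ} {e : A}
    (he : ∀ a, a * e = φ a • e) {ψ : A →ₗ[ℂ] ℂ} (hψ : ψ ∈ irrChars A)
    (hne : ψ ≠ φ.toLinearMap) : ψ e = 0 := by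
  obtain ⟨d, ρ, hd, hirr, htr⟩ := hψ
  by_cases h0 : ρ e = 0
  · rw [htr, h0, Matrix.trace_zero]
  · exfalso
    apply hne
    obtain ⟨v, hv⟩ : ∃ v, (ρ e).mulVec v ≠ 0 := by
      by_contra! hall
      refine h0 (Matrix.toLin'.injective ?_)
      ext v : 1
      simp
      ext
      simp [hall]
    -- A nonzero vector in the image of `ρ e` spans an invariant line on which `A` acts by `φ`;
    -- irreducibility makes that line the whole space.
    set w := (ρ e).mulVec v with hw
    have hact : ∀ a, (ρ a).mulVec w = φ a • w := fun a => by
      rw [hw, Matrix.mulVec_mulVec, ← map_mul, he, map_smul, Matrix.smul_mulVec]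
    have htop : Submodule.span ℂ {w} = ⊤ := by
      refine (hirr _ ?_).resolve_left ?_
      · intro a u hu
        obtain ⟨z, rfl⟩ := Submodule.mem_span_singleton.1 hu
        rw [Matrix.mulVec_smul, hact]
        exact Submodule.smul_mem _ _ (Submodule.smul_mem _ _ (Submodule.mem_span_singleton_self w))
      · rw [Submodule.span_singleton_eq_bot]; exact hv
    have hd1 : d = 1 := by
      have h1 := finrank_span_singleton (K := ℂ) hv
      rw [htop, finrank_top, Module.finrank_fin_fun] at h1
      exact h1
    subst hd1
    have hw0 : w 0 ≠ 0 := fun h => hv (by ext i; rw [Subsingleton.elim i 0, h]; rfl)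
    ext a
    have h1 := congrFun (hact a) 0
    simp only [Matrix.mulVec, dotProduct, Finset.univ_unique, Finset.sum_singleton,
      Fin.default_eq_zero, Pi.smul_apply, smul_eq_mul] at h1
    rw [htr, Matrix.trace_fin_one]
    exact mul_right_cancel₀ hw0 h1

theorem order_ne_zero (ht : IsStandardTableAlgebra b δ) : order b δ ≠ 0 :=
  (Finset.sum_pos (fun i _ => ht.degree.pos i) Finset.univ_nonempty).ne'

/-- The element `e = ∑ (φ(bᵢ*) / δᵢ) bᵢ` satisfies `a * e = φ a • e`, so every irreducible character
except `φ` kills it. Evaluating `τ` at `e`, whose `b 0`-coefficient is 1, isolates `m_φ`. -/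
theorem order_eq_multiplicity_mul (ht : IsStandardTableAlgebra b δ) {s : Fin r → Fin r}
    (hs : ∀ i, star (b i) = b (s i)) (hinv : Function.Involutive s) (hs0 : s 0 = 0)
    {m : (A →ₗ[ℂ] ℂ) → ℂ} (hm : IsMultiplicity b δ m) (φ : A →ₐ[ℂ] ℂ) :
    order b δ = m φ.toLinearMap * ∑ i, φ (b (s i)) / δ (b i) * φ (b i) := by
  have hδ0 : ∀ i, δ (b i) ≠ 0 := fun i => (ht.degree.pos i).ne'
  set e : A := ∑ i, (φ (b (s i)) / δ (b i)) • b i with he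
  have hbe : ∀ j, b j * e = φ (b j) • e := fun j => by
    refine b.ext_elem fun k => ?_
    simp only [he, Finset.mul_sum, mul_smul_comm, map_sum, map_smul, Finsupp.coe_finsetSum,
      Finset.sum_apply, Finsupp.smul_apply, smul_eq_mul, Module.Basis.repr_self]
    have h1 : ∀ i, φ (b (s i)) / δ (b i) * b.repr (b j * b i) k =
        (structConst b (s k) j (s i) * φ (b (s i))) / δ (b k) := fun i => by
      have h2 := structConst_cyclic ht.rba ht.standard hs hinv (s k) j i
      rw [hinv, degree_star_index ht.rba ht.standard hs] at h2
      have h3 : b.repr (b j * b i) k = structConst b j i k := rfl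
      have := hδ0 i
      have := hδ0 k
      rw [h3]
      field_simp
      linear_combination -φ (b (s i)) * h2
    simp only [h1]
    rw [← Finset.sum_div, Function.Bijective.sum_comp hinv.bijective
      (fun l => structConst b (s k) j l * φ (b l)), ← map_mul_eq_sum,
      Finset.sum_eq_single k]
    · simp; ring
    · intro l _ hl; simp [hl]
    · simp
  have hae : ∀ a, a * e = φ a • e := fun a => by
    have : LinearMap.mulRight ℂ e = φ.toLinearMap.smulRight e :=
      b.ext fun j => by simpa using hbe j
    simpa using LinearMap.congr_fun this a
  have hrepr : b.repr e 0 = 1 := by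
    simp only [he, map_sum, map_smul, Finsupp.coe_finsetSum,
      Finset.sum_apply, Finsupp.smul_apply, smul_eq_mul, Module.Basis.repr_self]
    rw [Finset.sum_eq_single 0]
    · simp [hs0, ht.rba.one]
    · intro l _ hl; simp [hl]
    · simp
  have hφirr : φ.toLinearMap ∈ irrChars A := by
    refine ⟨1, (Matrix.scalarAlgHom (Fin 1) ℂ).comp φ, one_pos, fun W _ => ?_, fun a => ?_⟩
    · have : IsSimpleModule ℂ (Fin 1 → ℂ) := isSimpleModule_iff_finrank_eq_one.2 (by simp)
      exact eq_bot_or_eq_top W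
    · simp
  have h1 : standardTrace b δ e = order b δ := by simp [standardTrace, hrepr]
  have hφe : φ e = ∑ i, φ (b (s i)) / δ (b i) * φ (b i) := by simp [he]
  rw [← h1, ← hφe, hm]
  -- With infinite support the `finsum` would default to 0, contradicting `τ e = n ≠ 0`.
  have hfin : (Function.support fun ψ => ∑ᶠ (_ : ψ ∈ irrChars A), m ψ • ψ).Finite := by
    by_contra hinf
    have h2 : standardTrace b δ = 0 := by rw [hm, finsum_of_infinite_support hinf]
    rw [h2] at h1
    exact order_ne_zero ht h1.symm
  rw [finsum_eq_sum _ hfin, LinearMap.sum_apply, Finset.sum_eq_single φ.toLinearMap]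
  · simp [finsum_eq_if, hφirr]
  · intro ψ _ hne
    by_cases hψ : ψ ∈ irrChars A
    · simp [finsum_eq_if, hψ, irrChar_apply_eq_zero hae hψ hne]
    · simp [finsum_eq_if, hψ]
  · intro hnot
    simp only [Set.Finite.mem_toFinset, Function.mem_support, not_not] at hnot
    rw [hnot]; rfl

end General

/-! ### Reduction to a real array graded by the second linear character. -/

theorem eq_one_of_re_eq_one {z : ℂ} (hre : z.re = 1) (hz : ‖z‖ ≤ 1) : z = 1 := by
  have h1 : z.re ^ 2 + z.im ^ 2 = ‖z‖ ^ 2 := by rw [Complex.sq_norm, Complex.normSq_apply]; ring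
  have h2 : ‖z‖ ^ 2 ≤ 1 := pow_le_one₀ (norm_nonneg _) hz
  have h3 : z.im = 0 := by
    have : z.im ^ 2 ≤ 0 := by rw [hre] at h1; linarith
    exact pow_eq_zero_iff two_ne_zero |>.1 (le_antisymm this (sq_nonneg _))
  exact Complex.ext (by simpa using hre) (by simpa using h3)

/-- Equality in the triangle inequality for a nonnegative combination of points of the
closed unit disc. -/
theorem eq_one_of_sum_mul_eq_sum {ι : Type*} [Fintype ι] {w : ι → ℝ} {z : ι → ℂ}
    (hw : ∀ i, 0 ≤ w i) (hz : ∀ i, ‖z i‖ ≤ 1) (h : ∑ i, (w i : ℂ) * z i = ((∑ i, w i : ℝ) : ℂ))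
    {i : ι} (hi : w i ≠ 0) : z i = 1 := by
  have h1 : ∑ i, w i * (1 - (z i).re) = 0 := by
    have h2 := congrArg Complex.re h
    simp only [Complex.re_sum, Complex.re_ofReal_mul, Complex.ofReal_re] at h2
    simp only [mul_sub, mul_one, Finset.sum_sub_distrib]
    linarith
  have h3 := (Finset.sum_eq_zero_iff_of_nonneg fun j _ => mul_nonneg (hw j)
    (sub_nonneg.2 ((Complex.re_le_norm _).trans (hz j)))).1 h1 i (Finset.mem_univ i)
  have h4 := (mul_eq_zero.1 h3).resolve_left hi
  exact eq_one_of_re_eq_one (by linarith) (hz i)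

/-- The values `T i j k` of the trace form on triple products of the basis of a non-real
bipartite algebra; `s` is the involution on indices, `D` the degree, `f` the normalised second
linear character. -/
structure IsTripleArray (s : Fin 6 → Fin 6) (D : Fin 6 → ℝ) (f : Fin 6 → ℂ)
    (T : Fin 6 → Fin 6 → Fin 6 → ℝ) : Prop where
  cyclic : ∀ i j k, T i j k = T j k i
  star : ∀ i j k, T (s k) (s j) (s i) = T i j k
  zero : ∀ i j, T i j 0 = if j = s i then D i else 0
  sum : ∀ i j, ∑ k, T i j k = D i * D j
  -- `T i j (s l) / D l` is the structure constant `λ_{ijl}`.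
  assoc : ∀ i j k m, ∑ l, T i j (s l) / D l * T l k m = ∑ l, T j k (s l) / D l * T i l m
  pos : ∀ i, 0 < D i
  degree_zero : D 0 = 1
  degree_star : ∀ i, D (s i) = D i
  grade : ∀ i j k, T i j k ≠ 0 → f i * f j * f k = 1
  grade_star : ∀ i, f (s i) * f i = 1
  grade_eq_one : ∀ i, f i = 1 ↔ i = 0 ∨ i = 4 ∨ i = 5
  involutive : Function.Involutive s
  star_zero : s 0 = 0
  star_four : s 4 = 5

theorem IsNonRealBipartite.exists_tripleArray {A : Type*} [Ring A] [StarRing A] [Algebra ℂ A]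
    [StarModule ℂ A] {b : Module.Basis (Fin 6) ℂ A} {δ φ : A →ₐ[ℂ] ℂ}
    (h : IsNonRealBipartite b δ φ) :
    ∃ s D f T, IsTripleArray s D f T ∧ (∀ i, δ (b i) = (D i : ℂ)) ∧
      ∀ i j k, structConst b i j (s k) = ((T i j k / D k : ℝ) : ℂ) := by
  have ht := h.table
  have hb := ht.rba
  have hst := ht.standard
  obtain ⟨s, hs, hinv, hs0⟩ := hb.exists_star
  have hD : ∀ i, δ (b i) = ((δ (b i)).re : ℂ) := fun i =>
    Complex.eq_re_of_ofReal_le (r := 0) (by simpa using (ht.degree.pos i).le)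
  have hc : ∀ i j k, structConst b i j k = ((structConst b i j k).re : ℂ) := fun i j k =>
    Complex.eq_re_of_ofReal_le (r := 0) (by simpa using ht.nonneg i j k)
  obtain ⟨D, hD⟩ : ∃ D : Fin 6 → ℝ, ∀ i, δ (b i) = (D i : ℂ) := ⟨_, hD⟩
  obtain ⟨c, hc⟩ : ∃ c : Fin 6 → Fin 6 → Fin 6 → ℝ, ∀ i j k, structConst b i j k = (c i j k : ℂ) :=
    ⟨_, hc⟩
  have hDpos : ∀ i, 0 < D i := fun i => by
    have := ht.degree.pos i
    rw [hD] at this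
    exact_mod_cast this
  have hDne : ∀ i, D i ≠ 0 := fun i => (hDpos i).ne'
  have hDneC : ∀ i, (D i : ℂ) ≠ 0 := fun i => by exact_mod_cast hDne i
  have hcnn : ∀ i j k, 0 ≤ c i j k := fun i j k => by
    have := ht.nonneg i j k
    rw [hc] at this
    exact_mod_cast this
  have hsum : ∀ i j, ∑ k, c i j k * D k = D i * D j := fun i j => by
    have := map_mul_eq_sum b δ i j
    simp only [hD, hc] at this
    exact_mod_cast this.symm
  have hDs : ∀ i, D (s i) = D i := fun i => by
    have := degree_star_index hb hst hs i
    rw [hD, hD] at this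
    exact_mod_cast this
  have hcyc : ∀ i j k, c i j (s k) * D k = c j k (s i) * D i := fun i j k => by
    have := structConst_cyclic hb hst hs hinv i j k
    simp only [hD, hc] at this
    exact_mod_cast this
  have hstar : ∀ i j k, c (s j) (s i) (s k) = c i j k := fun i j k => by
    have := structConst_star hb hs hinv i j k
    simp only [hc] at this
    exact_mod_cast this
  have hzero : ∀ i j, c i j 0 = if j = s i then D i else 0 := fun i j => by
    have := structConst_zero_right hb hst hs i j
    simp only [hD, hc] at this
    split_ifs at this ⊢ <;> exact_mod_cast this
  have hassoc : ∀ i j k m, ∑ l, c i j l * c l k m = ∑ l, c j k l * c i l m := fun i j k m => by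
    have := structConst_assoc b i j k m
    simp only [hc] at this
    exact_mod_cast this
  have hD0 : D 0 = 1 := by
    have := hD 0
    rw [hb.one, map_one] at this
    exact_mod_cast this.symm
  obtain ⟨m, hm, hm1⟩ := h.mult
  set f : Fin 6 → ℂ := fun i => φ (b i) / D i with hf
  have hφf : ∀ i, φ (b i) = D i * f i := fun i => by
    have := hDneC i
    simp only [hf]
    field_simp
  have hfle : ∀ i, ‖f i‖ ≤ 1 := fun i => by
    have := norm_map_le_degree ht φ i
    rw [hφf, norm_mul, hD] at this
    have hp : 0 < ‖(D i : ℂ)‖ := norm_pos_iff.2 (hDneC i)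
    exact le_of_mul_le_mul_left (by linarith) hp
  -- With `m_φ = 1` the multiplicity formula says that the average of `f (s i) * f i` with weights
  -- `D i` is 1, while each term lies in the unit disc.
  have hfs : ∀ i, f (s i) * f i = 1 := by
    intro i
    refine eq_one_of_sum_mul_eq_sum (w := D) (z := fun i => f (s i) * f i)
      (fun i => (hDpos i).le) (fun i => ?_) ?_ (hDne i)
    · rw [norm_mul]; exact mul_le_one₀ (hfle _) (norm_nonneg _) (hfle _)
    · have := order_eq_multiplicity_mul ht hs hinv hs0 hm φ
      rw [hm1, one_mul, order] at this
      simp only [hD] at this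
      rw [Complex.ofReal_sum, this]
      refine Finset.sum_congr rfl fun i _ => ?_
      have := hDneC i
      rw [hφf, hφf, hDs]
      field_simp
  have hfnorm : ∀ i, ‖f i‖ = 1 := fun i => by
    have h1 : ‖f (s i)‖ * ‖f i‖ = 1 := by rw [← norm_mul, hfs, norm_one]
    refine le_antisymm (hfle i) ?_
    nlinarith [hfle i, hfle (s i), norm_nonneg (f i)]
  -- Dividing the expansion of `φ (b i) * φ (b j)` by `f i * f j` gives again an equality case of
  -- the triangle inequality, with weights `c i j k * D k`.
  have hgrade : ∀ i j k, c i j k ≠ 0 → f k * (f (s i) * f (s j)) = 1 := by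
    intro i j k hk
    refine eq_one_of_sum_mul_eq_sum (w := fun k => c i j k * D k)
      (z := fun k => f k * (f (s i) * f (s j)))
      (fun k => mul_nonneg (hcnn _ _ _) (hDpos k).le) (fun k => ?_) ?_
      (mul_ne_zero hk (hDne k))
    · simp [hfnorm]
    · have h1 := map_mul_eq_sum b φ i j
      simp only [hφf, hc] at h1
      rw [hsum]
      push_cast
      have h2 := congrArg (· * (f (s i) * f (s j))) h1
      simp only [Finset.sum_mul] at h2
      have h3 := hfs i
      have h4 := hfs j
      calc _ = ∑ k, (c i j k : ℂ) * (D k * f k) * (f (s i) * f (s j)) :=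
            Finset.sum_congr rfl fun k _ => by ring
        _ = _ := by
            rw [← h2]
            linear_combination (D i * D j * (f (s j) * f j) : ℂ) * h3 + (D i * D j : ℂ) * h4
  have hker : ∀ i, f i = 1 ↔ i = 0 ∨ i = 4 ∨ i = 5 := by
    intro i
    have h1 : f i = 1 ↔ b i ∈ charKer b δ φ.toLinearMap := by
      simp only [charKer, Set.mem_ofPred_eq, Set.mem_range_self, true_and,
        AlgHom.toLinearMap_apply, hb.one, map_one, mul_one, hf, hD]
      rw [div_eq_one_iff_eq (hDneC i)]
    rw [h1, h.ker]
    simp [b.injective.eq_iff]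
  refine ⟨s, D, f, fun i j k => c i j (s k) * D k, ?_, hD, fun i j k => ?_⟩
  · refine ⟨hcyc, fun i j k => ?_, fun i j => ?_, fun i j => ?_, fun i j k m => ?_, hDpos, hD0,
      hDs, fun i j k hk => ?_, hfs, hker, hinv, hs0, b.injective ?_⟩
    · rw [hinv, hDs, hcyc i j k, ← hstar j k (s i), hinv]
    · rw [hs0, hzero, hD0, mul_one]
    · rw [← hsum, ← Function.Bijective.sum_comp hinv.bijective]
      exact Finset.sum_congr rfl fun k _ => by rw [hDs, hinv]
    · simp only [hinv _, hDs]
      have h1 := congrArg (· * D m) (hassoc i j k (s m))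
      simp only [Finset.sum_mul] at h1
      calc _ = ∑ l, c i j l * c l k (s m) * D m :=
            Finset.sum_congr rfl fun l _ => by have := hDne l; field_simp
        _ = _ := h1
        _ = _ := Finset.sum_congr rfl fun l _ => by have := hDne l; field_simp
    · have h1 := hgrade i j (s k) (left_ne_zero_of_mul hk)
      have h2 := hfs i
      have h3 := hfs j
      have h4 := hfs k
      linear_combination -f i * f j * f k * h1 + (f j * f (s j) * f k * f (s k)) * h2 +
        f j * f (s j) * h4 + h3
    · rw [← hs, h.star_four]
  · have := hDne k
    rw [hc, mul_div_cancel_right₀ _ this]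

/-! ### A star that swaps two elements outside the kernel forces commutativity. -/

/-- A cyclic array is automatically symmetric on triples with a repeated index, so one transposition
for each 3-subset of the indices suffices; `ho` covers the subsets containing `o`. -/
theorem symm_of_cyclic {ι R : Type*} {T : ι → ι → ι → R} (cyc : ∀ i j k, T i j k = T j k i)
    {o u v p q r : ι} (hmem : ∀ i, i = o ∨ i = u ∨ i = v ∨ i = p ∨ i = q ∨ i = r)
    (ho : ∀ i j, T o i j = T i o j)
    (huvp : T u v p = T v u p) (huvq : T u v q = T v u q) (huvr : T u v r = T v u r)
    (hupq : T u p q = T u q p) (hupr : T u p r = T u r p) (huqr : T u q r = T u r q)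
    (hvpq : T v p q = T v q p) (hvpr : T v p r = T v r p) (hvqr : T v q r = T v r q)
    (hpqr : T p q r = T q p r) (i j k : ι) : T i j k = T j i k := by
  have ho' : ∀ i j, T i j o = T j i o := fun i j =>
    (cyc o i j).symm.trans ((ho i j).trans ((cyc i o j).trans (cyc o j i)))
  have aab : ∀ i j, T i j i = T j i i := fun i j => cyc i j i
  have abb : ∀ i j, T j i i = T i j i := fun i j => (cyc i j i).symm
  have move : ∀ {i j k}, T i j k = T i k j → T j k i = T k j i := fun {i j k} h => by
    rw [← cyc, h, cyc]
  have move' : ∀ {i j k}, T i j k = T i k j → T i j k = T j i k := fun {i j k} h => by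
    rw [h, ← cyc]
  have flip : ∀ {i j k}, T i j k = T j i k → T i j k = T i k j := fun {i j k} h => by
    rw [h, cyc]
  have e1 := flip huvp
  have e2 := flip huvq
  have e3 := flip huvr
  have e4 := flip hpqr
  rcases hmem k with rfl | rfl | rfl | rfl | rfl | rfl <;>
  rcases hmem i with rfl | rfl | rfl | rfl | rfl | rfl <;>
  rcases hmem j with rfl | rfl | rfl | rfl | rfl | rfl <;>
  first
  | rfl | apply ho | apply Eq.symm; apply ho
  | apply ho' | apply aab | apply abb
  | (first
      | apply move; (first | assumption | (apply Eq.symm; assumption))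
      | apply move'; (first | assumption | (apply Eq.symm; assumption))
      | apply Eq.symm; apply move'; (first | assumption | (apply Eq.symm; assumption)))

namespace IsTripleArray

variable {s : Fin 6 → Fin 6} {D : Fin 6 → ℝ} {f : Fin 6 → ℂ} {T : Fin 6 → Fin 6 → Fin 6 → ℝ}

theorem star_five (h : IsTripleArray s D f T) : s 5 = 4 := by
  rw [← h.star_four, h.involutive]

theorem eq_zero_of_grade_ne (h : IsTripleArray s D f T) {i j k : Fin 6}
    (hne : f i * f j * f k ≠ 1) : T i j k = 0 :=
  not_imp_comm.1 (h.grade i j k) hne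

theorem zero_left (h : IsTripleArray s D f T) (i j : Fin 6) :
    T 0 i j = if j = s i then D i else 0 := by
  rw [h.cyclic, h.zero]

/-- If the star exchanges two of the basis elements outside the kernel, the algebra is
commutative. -/
theorem symm_of_swap (h : IsTripleArray s D f T) {p q r : Fin 6} (hpq : s p = q) (hr : s r = r)
    (hmem : ∀ i, i = 0 ∨ i = 4 ∨ i = 5 ∨ i = p ∨ i = q ∨ i = r)
    (hsum : ∀ g : Fin 6 → ℝ, ∑ i, g i = g 0 + g 4 + g 5 + g p + g q + g r)
    (hp : f p ≠ 1) (hq : f q ≠ 1) (hr1 : f r ≠ 1) (i j k : Fin 6) : T i j k = T j i k := by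
  have hqp : s q = p := by rw [← hpq, h.involutive]
  have f4 : f 4 = 1 := (h.grade_eq_one 4).2 (by simp)
  have f5 : f 5 = 1 := (h.grade_eq_one 5).2 (by simp)
  have hf : f p * f q = 1 := by rw [← h.grade_star q, hqp]
  have hDpq : D q = D p := by rw [← hpq, h.degree_star]
  have s4 := h.star_four
  have s5 := h.star_five
  have cyc := h.cyclic
  have z : ∀ a b c, f a * f b * f c ≠ 1 → T a b c = 0 := fun a b c => h.eq_zero_of_grade_ne
  have z0 : ∀ a b, T 0 a b = T a 0 b := fun a b => by
    rw [cyc a 0 b, h.zero_left, h.zero_left]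
    by_cases hab : b = s a
    · rw [if_pos hab, if_pos (by rw [hab, h.involutive]), hab, h.degree_star]
    · rw [if_neg hab, if_neg]
      rintro rfl
      exact hab (h.involutive b).symm
  have z45p : T 4 5 p = 0 := z _ _ _ (by simpa [f4, f5] using hp)
  have z54p : T 5 4 p = 0 := z _ _ _ (by simpa [f4, f5] using hp)
  have z44p : T 4 4 p = 0 := z _ _ _ (by simpa [f4, f5] using hp)
  have z45q : T 4 5 q = 0 := z _ _ _ (by simpa [f4, f5] using hq)
  have z54q : T 5 4 q = 0 := z _ _ _ (by simpa [f4, f5] using hq)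
  have z44q : T 4 4 q = 0 := z _ _ _ (by simpa [f4, f5] using hq)
  have z45r : T 4 5 r = 0 := z _ _ _ (by simpa [f4, f5] using hr1)
  have z54r : T 5 4 r = 0 := z _ _ _ (by simpa [f4, f5] using hr1)
  have zpqr : T p q r = 0 := z _ _ _ (by rwa [hf, one_mul])
  have zqpr : T q p r = 0 := z _ _ _ (by rwa [mul_comm (f q), hf, one_mul])
  have zpqp : T p q p = 0 := z _ _ _ (by rwa [hf, one_mul])
  have zpqq : T p q q = 0 := z _ _ _ (by rwa [hf, one_mul])
  have zqpp : T q p p = 0 := z _ _ _ (by rwa [mul_comm (f q), hf, one_mul])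
  have zqpq : T q p q = 0 := z _ _ _ (by rwa [mul_comm (f q), hf, one_mul])
  have e5pq : T 5 p q = T 4 p q := by
    have := h.star 5 p q
    rw [s5, hpq, hqp] at this
    rw [← this, cyc 4 p q]
  have e5qp : T 5 q p = T 4 q p := by
    have := h.star 5 q p
    rw [s5, hpq, hqp] at this
    rw [← this, cyc 4 q p]
  have e5pr : T 5 p r = T 4 r q := by
    have := h.star 5 p r
    rw [s5, hpq, hr] at this
    rw [← this, cyc 4 r q]
  have e5rp : T 5 r p = T 4 q r := by
    have := h.star 5 r p
    rw [s5, hpq, hr] at this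
    rw [← this, cyc 4 q r]
  have e5qr : T 5 q r = T 4 r p := by
    have := h.star 5 q r
    rw [s5, hqp, hr] at this
    rw [← this, cyc 4 r p]
  have e5rq : T 5 r q = T 4 p r := by
    have := h.star 5 r q
    rw [s5, hqp, hr] at this
    rw [← this, cyc 4 p r]
  have sum := h.sum
  simp only [hsum, h.zero] at sum
  -- The star identifies `T 5 p q` with `T 4 p q`, so both row sums read `2x + D p = D p ^ 2`.
  have hpq4 : T 4 p q = T 4 q p := by
    have h1 := sum p q
    have h2 := sum q p
    rw [if_pos hpq.symm, ← cyc 4 p q, ← cyc 5 p q, e5pq] at h1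
    rw [if_pos hqp.symm, ← cyc 4 q p, ← cyc 5 q p, e5qp, hDpq] at h2
    rw [hDpq] at h1
    linarith
  -- Left and right multiplication by `b 4` give equal sums; with `hpq4` this leaves only the terms
  -- involving `r`.
  have hcol : ∀ a, T 4 4 a = 0 → T 4 5 a = 0 → T 5 4 a = 0 → a ≠ 4 → a ≠ 5 →
      T 4 a p + T 4 a q + T 4 a r = T 4 p a + T 4 q a + T 4 r a := by
    intro a h1 h2 h3 h4 h5
    have h6 := sum 4 a
    have h7 := sum a 4
    rw [s4, if_neg h5, cyc 4 a 4, cyc a 4 4, h1, cyc 4 a 5, cyc a 5 4, h3] at h6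
    rw [if_neg, cyc a 4 4, h1, cyc a 4 5, h2, cyc a 4 p, cyc a 4 q, cyc a 4 r] at h7
    · linarith
    · intro h8
      exact h5 (by rw [← h.involutive a, ← h8, s4])
  have hpr4 : T 4 p r = T 4 r p := by
    have := hcol p z44p z45p z54p (fun h => hp (by rw [h, f4])) (fun h => hp (by rw [h, f5]))
    linarith
  have hqr4 : T 4 q r = T 4 r q := by
    have := hcol q z44q z45q z54q (fun h => hq (by rw [h, f4])) (fun h => hq (by rw [h, f5]))
    linarith
  exact symm_of_cyclic cyc hmem z0 (z45p.trans z54p.symm) (z45q.trans z54q.symm)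
    (z45r.trans z54r.symm) hpq4 hpr4 hqr4 (e5pq.trans (hpq4.trans e5qp.symm))
    (e5pr.trans (hqr4.symm.trans e5rp.symm)) (e5qr.trans (hpr4.symm.trans e5rq.symm))
    (zpqr.trans zqpr.symm) i j k

end IsTripleArray

/-! ### The self-adjoint case: `T` from the degrees and one square root. -/

namespace IsTripleArray

variable {s : Fin 6 → Fin 6} {D : Fin 6 → ℝ} {f : Fin 6 → ℂ} {T : Fin 6 → Fin 6 → Fin 6 → ℝ}

/-- An involution of `{1, 2, 3}` is trivial or a transposition, and `symm_of_swap` rules out the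
transpositions. -/
theorem star_eq_of_not_symm (h : IsTripleArray s D f T) (hns : ¬ ∀ i j k, T i j k = T j i k) :
    s 1 = 1 ∧ s 2 = 2 ∧ s 3 = 3 := by
  have hs0 := h.star_zero
  have hs4 := h.star_four
  have hs5 := h.star_five
  have hinj : ∀ i j, s i = s j → i = j := fun i j e => h.involutive.injective e
  have hne : ∀ i, i ≠ 0 → i ≠ 4 → i ≠ 5 → f i ≠ 1 := fun i h0 h4 h5 e => by
    rcases (h.grade_eq_one i).1 e with e | e | e <;> contradiction
  have f1 : f 1 ≠ 1 := hne 1 (by decide) (by decide) (by decide)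
  have f2 : f 2 ≠ 1 := hne 2 (by decide) (by decide) (by decide)
  have f3 : f 3 ≠ 1 := hne 3 (by decide) (by decide) (by decide)
  have not12 : ¬ (s 1 = 2 ∧ s 3 = 3) := fun e => hns fun i j k =>
    h.symm_of_swap e.1 e.2 (by decide) (fun g => by rw [Fin.sum_univ_six]; ring) f1 f2 f3 i j k
  have not13 : ¬ (s 1 = 3 ∧ s 2 = 2) := fun e => hns fun i j k =>
    h.symm_of_swap e.1 e.2 (by decide) (fun g => by rw [Fin.sum_univ_six]; ring) f1 f3 f2 i j k
  have not23 : ¬ (s 2 = 3 ∧ s 1 = 1) := fun e => hns fun i j k =>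
    h.symm_of_swap e.1 e.2 (by decide) (fun g => by rw [Fin.sum_univ_six]; ring) f2 f3 f1 i j k
  have hinv : ∀ i, s (s i) = i := h.involutive
  clear hns f1 f2 f3 hne h
  have hmem : ∀ i : Fin 6, i ≠ 0 → i ≠ 4 → i ≠ 5 → i = 1 ∨ i = 2 ∨ i = 3 := by decide
  have hs : ∀ i, i ≠ 0 → i ≠ 4 → i ≠ 5 → s i = 1 ∨ s i = 2 ∨ s i = 3 := fun i h0 h4 h5 =>
    hmem _ (fun e => h0 (by rw [← hinv i, e, hs0])) (fun e => h5 (by rw [← hinv i, e, hs4]))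
      (fun e => h4 (by rw [← hinv i, e, hs5]))
  have hcon : ∀ {i j a : Fin 6}, s i = a → s j = a → i = j := fun hi hj =>
    hinj _ _ (hi.trans hj.symm)
  have hflip : ∀ {i a : Fin 6}, s i = a → s a = i := fun hi => by rw [← hi, hinv]
  rcases hs 1 (by decide) (by decide) (by decide) with e1 | e1 | e1
  · rcases hs 2 (by decide) (by decide) (by decide) with e2 | e2 | e2
    · exact absurd (hcon e1 e2) (by decide)
    · rcases hs 3 (by decide) (by decide) (by decide) with e3 | e3 | e3
      · exact absurd (hcon e1 e3) (by decide)
      · exact absurd (hcon e2 e3) (by decide)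
      · exact ⟨e1, e2, e3⟩
    · exact absurd ⟨e2, e1⟩ not23
  · rcases hs 3 (by decide) (by decide) (by decide) with e3 | e3 | e3
    · exact absurd (hcon e3 (hflip e1)) (by decide)
    · exact absurd (hcon e3 e1) (by decide)
    · exact absurd ⟨e1, e3⟩ not12
  · rcases hs 2 (by decide) (by decide) (by decide) with e2 | e2 | e2
    · exact absurd (hcon e2 (hflip e1)) (by decide)
    · exact absurd ⟨e1, e2⟩ not13
    · exact absurd (hcon e2 e1) (by decide)

theorem grade_eq_neg_one (h : IsTripleArray s D f T) {i : Fin 6} (hs : s i = i)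
    (h0 : i ≠ 0) (h4 : i ≠ 4) (h5 : i ≠ 5) : f i = -1 := by
  have h1 := h.grade_star i
  rw [hs] at h1
  refine (mul_self_eq_one_iff.1 h1).resolve_left fun e => ?_
  rcases (h.grade_eq_one i).1 e with e | e | e <;> contradiction

/-- The trace form on triple products when `b 1, b 2, b 3` are self-adjoint; it is determined
by the degrees and the choice of a square root `t` of `δ₁ δ₂ δ₃`. -/
structure IsParametrized (D : Fin 6 → ℝ) (T : Fin 6 → Fin 6 → Fin 6 → ℝ) (t : ℝ) : Prop where
  sq : t ^ 2 = D 1 * D 2 * D 3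
  order : 1 + 2 * D 4 = D 1 + D 2 + D 3
  e444 : T 4 4 4 = D 4 * (D 4 + 1) / 2
  e445 : T 4 4 5 = D 4 * (D 4 - 1) / 2
  e411 : T 4 1 1 = D 1 * (D 1 - 1) / 2
  e422 : T 4 2 2 = D 2 * (D 2 - 1) / 2
  e433 : T 4 3 3 = D 3 * (D 3 - 1) / 2
  e412 : T 4 1 2 = (D 1 * D 2 + t) / 2
  e421 : T 4 2 1 = (D 1 * D 2 - t) / 2
  e423 : T 4 2 3 = (D 2 * D 3 + t) / 2
  e432 : T 4 3 2 = (D 2 * D 3 - t) / 2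
  e431 : T 4 3 1 = (D 1 * D 3 + t) / 2
  e413 : T 4 1 3 = (D 1 * D 3 - t) / 2

/-- The grading kills every triple with an odd number of indices in `{1, 2, 3}`. Row sums and the
star leave one unknown, and associativity gives its square. -/
theorem exists_isParametrized (h : IsTripleArray s D f T) (s1 : s 1 = 1) (s2 : s 2 = 2)
    (s3 : s 3 = 3) : ∃ t, IsParametrized D T t := by
  have s0 := h.star_zero
  have s4 := h.star_four
  have s5 := h.star_five
  have cyc := h.cyclic
  have f1 : f 1 = -1 := h.grade_eq_neg_one s1 (by decide) (by decide) (by decide)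
  have f2 : f 2 = -1 := h.grade_eq_neg_one s2 (by decide) (by decide) (by decide)
  have f3 : f 3 = -1 := h.grade_eq_neg_one s3 (by decide) (by decide) (by decide)
  have f4 : f 4 = 1 := (h.grade_eq_one 4).2 (by simp)
  have f5 : f 5 = 1 := (h.grade_eq_one 5).2 (by simp)
  have hD5 : D 5 = D 4 := by rw [← s4, h.degree_star]
  have p1 := h.pos 1
  have p2 := h.pos 2
  have p3 := h.pos 3
  have p4 := h.pos 4
  have z : ∀ {a b c}, f a * f b * f c = -1 → T a b c = 0 := fun e =>
    h.eq_zero_of_grade_ne (by rw [e]; norm_num)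
  have star5 : ∀ i j, s i = i → s j = j → T 5 i j = T 4 j i := fun i j hi hj => by
    have := h.star 5 i j
    rw [hi, hj, s5] at this
    rw [← this, cyc 4 j i]
  have hrow : ∀ i, s i = i → f i = -1 → i ≠ 4 → i ≠ 5 →
      T 4 i 1 + T 4 i 2 + T 4 i 3 = D 4 * D i := fun i hi fi i4 i5 => by
    have := h.sum 4 i
    rw [Fin.sum_univ_six, h.zero, s4, if_neg i5, z (c := 4) (by rw [f4, fi]; norm_num),
      z (c := 5) (by rw [f4, f5, fi]; norm_num)] at this
    linarith
  have hadd : ∀ i j, s i = i → s j = j → f i = -1 → f j = -1 →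
      T 4 i j + T 4 j i + (if j = i then D i else 0) = D i * D j := fun i j hi hj fi fj => by
    have := h.sum i j
    rw [Fin.sum_univ_six, h.zero, hi, z (c := 1) (by rw [fi, fj, f1]; norm_num),
      z (c := 2) (by rw [fi, fj, f2]; norm_num), z (c := 3) (by rw [fi, fj, f3]; norm_num),
      ← cyc 4 i j, ← cyc 5 i j, star5 i j hi hj] at this
    linarith
  have r1 := hrow 1 s1 f1 (by decide) (by decide)
  have r2 := hrow 2 s2 f2 (by decide) (by decide)
  have r3 := hrow 3 s3 f3 (by decide) (by decide)
  have a11 := hadd 1 1 s1 s1 f1 f1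
  have a22 := hadd 2 2 s2 s2 f2 f2
  have a33 := hadd 3 3 s3 s3 f3 f3
  have a12 := hadd 1 2 s1 s2 f1 f2
  have a13 := hadd 1 3 s1 s3 f1 f3
  have a23 := hadd 2 3 s2 s3 f2 f3
  rw [if_pos rfl] at a11 a22 a33
  rw [if_neg (by decide)] at a12 a13 a23
  -- Add the sums for `b 4 * b 1` and `b 1 * b 4`, pair terms by `a11`, `a12`, `a13`, and divide by
  -- `D 1`.
  have horder : 1 + 2 * D 4 = D 1 + D 2 + D 3 := by
    have c := h.sum 1 4
    rw [Fin.sum_univ_six, h.zero, s1, if_neg (by decide), z (c := 4) (by rw [f1, f4]; norm_num),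
      z (c := 5) (by rw [f1, f4, f5]; norm_num), cyc 1 4 1, cyc 1 4 2, cyc 1 4 3] at c
    refine mul_left_cancel₀ p1.ne' ?_
    linarith
  have e455 : T 4 5 5 = T 4 4 5 := by
    have := h.star 4 4 5
    rwa [s4, s5] at this
  have e454 : T 4 5 4 = T 4 4 5 := (cyc 4 4 5).symm
  have c44 := h.sum 4 4
  rw [Fin.sum_univ_six, h.zero, s4, if_neg (by decide), z (c := 1) (by rw [f4, f1]; norm_num),
    z (c := 2) (by rw [f4, f2]; norm_num), z (c := 3) (by rw [f4, f3]; norm_num)] at c44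
  have c45 := h.sum 4 5
  rw [Fin.sum_univ_six, h.zero, s4, if_pos rfl, z (c := 1) (by rw [f4, f5, f1]; norm_num),
    z (c := 2) (by rw [f4, f5, f2]; norm_num), z (c := 3) (by rw [f4, f5, f3]; norm_num),
    e455, e454, hD5] at c45
  -- As `b 5` is the adjoint of `b 4`, one side becomes the sum of the squares `T 4 1 l ^ 2 / D l`;
  -- the other involves only entries already determined.
  have quad := h.assoc 5 4 1 1
  simp only [Fin.sum_univ_six, s0, s1, s2, s3, s4, s5] at quad
  have e540 : T 5 4 0 = D 4 := by rw [h.zero, s5, if_pos rfl, hD5]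
  have e545 : T 5 4 5 = T 4 4 5 := by rw [cyc, e455]
  have e544 : T 5 4 4 = T 4 4 5 := cyc 5 4 4
  have e011 : T 0 1 1 = D 1 := by rw [h.zero_left, s1, if_pos rfl]
  have e410 : T 4 1 0 = 0 := by rw [h.zero, s4, if_neg (by decide)]
  rw [e540, e545, e544, e011, e410, h.degree_zero, hD5,
    z (a := 5) (b := 4) (c := 1) (by rw [f5, f4, f1]; norm_num),
    z (a := 5) (b := 4) (c := 2) (by rw [f5, f4, f2]; norm_num),
    z (a := 5) (b := 4) (c := 3) (by rw [f5, f4, f3]; norm_num),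
    z (a := 4) (b := 1) (c := 4) (by rw [f4, f1]; norm_num),
    z (a := 4) (b := 1) (c := 5) (by rw [f5, f4, f1]; norm_num),
    star5 1 1 s1 s1, star5 2 1 s2 s1, star5 3 1 s3 s1] at quad
  have x11 : T 4 1 1 = D 1 * (D 1 - 1) / 2 := by linarith
  have x22 : T 4 2 2 = D 2 * (D 2 - 1) / 2 := by linarith
  have x33 : T 4 3 3 = D 3 * (D 3 - 1) / 2 := by linarith
  obtain ⟨t, ht⟩ : ∃ t, t = 2 * T 4 1 2 - D 1 * D 2 := ⟨_, rfl⟩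
  have hd : D 4 = (D 1 + D 2 + D 3 - 1) / 2 := by linarith
  have x445 : T 4 4 5 = D 4 * (D 4 - 1) / 2 := by linarith
  have x12 : T 4 1 2 = (D 1 * D 2 + t) / 2 := by linarith
  have x13 : T 4 1 3 = (D 1 * D 3 - t) / 2 := by rw [hd] at r1; linarith
  refine ⟨t, ⟨?_, horder, by linarith, x445, x11, x22, x33, x12, by linarith,
    by rw [hd] at r2; linarith, by rw [hd] at r2; linarith, by linarith, x13⟩⟩
  rw [x11, x12, x13, x445] at quad
  field_simp at quad
  rw [hd] at quad
  have h0 : D 1 * (2 * D 4) * (D 2 + D 3) * (t ^ 2 - D 1 * D 2 * D 3) = 0 := by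
    rw [hd]
    linear_combination -2 * quad
  have := (mul_eq_zero.1 h0).resolve_left (by positivity)
  linarith

end IsTripleArray

/-! ### Integrality implies the arithmetic condition. -/

/-- The arithmetic condition on the degrees that characterises integrality. -/
def ArithmeticCondition (d₁ d₂ d₃ d₄ α γ k₁ k₂ : ℤ) : Prop :=
  (0 < α ∧ Odd α) ∧ (0 < γ ∧ Odd γ) ∧ (0 < k₁ ∧ Odd k₁) ∧ (0 < k₂ ∧ Odd k₂) ∧
    d₁ = α * γ * k₁ ∧ d₂ = α * γ * k₂ ∧ d₃ = α ^ 2 * k₁ * k₂ ∧ Int.gcd k₁ k₂ = 1 ∧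
    α ^ 2 < 2 * γ ∧ d₄ ∣ γ * k₁ * k₂ ∧ d₄ ∣ γ * k₁ * (α * γ * k₁ - 1) ∧
    d₄ ∣ γ * k₂ * (α * γ * k₂ - 1) ∧ d₄ ∣ k₁ * k₂ * (α ^ 2 * k₁ * k₂ - 1)

/-- Here `uᵢ` stands for `t / δᵢ`. Writing `u₁ = αk₂`, `u₂ = αk₁` with `α` their gcd, and `γ = u₃`,
yields the shape of the degrees. -/
theorem exists_arithmeticCondition {d₁ d₂ d₃ d₄ u₁ u₂ u₃ : ℤ} (o₁ : Odd d₁) (o₂ : Odd d₂)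
    (p₁ : 0 < d₁) (p₂ : 0 < d₂) (p₃ : 0 < d₃) (h₁ : u₂ * u₃ = d₁)
    (h₂ : u₁ * u₃ = d₂) (h₃ : u₁ * u₂ = d₃) (horder : 1 + 2 * d₄ = d₁ + d₂ + d₃)
    (ht : d₄ ∣ u₁ * d₁) (q₁ : d₄ ∣ d₁ * (d₁ - 1)) (q₂ : d₄ ∣ d₂ * (d₂ - 1))
    (q₃ : d₄ ∣ d₃ * (d₃ - 1)) : ∃ α γ k₁ k₂, ArithmeticCondition d₁ d₂ d₃ d₄ α γ k₁ k₂ := by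
  -- Changing all three signs replaces `t` by `-t`, that is, takes the other square root.
  wlog hu : 0 < u₁ generalizing u₁ u₂ u₃
  · have hne : u₁ ≠ 0 := by rintro rfl; simp at h₃; omega
    exact this (u₁ := -u₁) (u₂ := -u₂) (u₃ := -u₃) (by linarith) (by linarith) (by linarith)
      (by rw [neg_mul]; exact (dvd_neg).2 ht) (by omega)
  have hu₂ : 0 < u₂ := pos_of_mul_pos_right (h₃ ▸ p₃) hu.le
  have hu₃ : 0 < u₃ := pos_of_mul_pos_right (h₂ ▸ p₂) hu.le
  have hg : 0 < Int.gcd u₁ u₂ := Int.gcd_pos_of_ne_zero_left _ hu.ne'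
  obtain ⟨k₂, k₁, hcop, e₁, e₂⟩ := Int.exists_gcd_one hg
  obtain ⟨α, hα⟩ : ∃ α : ℤ, α = (Int.gcd u₁ u₂ : ℤ) := ⟨_, rfl⟩
  have α0 : 0 < α := by rw [hα]; exact_mod_cast hg
  rw [← hα] at e₁ e₂
  have k₂0 : 0 < k₂ := pos_of_mul_pos_left (e₁ ▸ hu) α0.le
  have k₁0 : 0 < k₁ := pos_of_mul_pos_left (e₂ ▸ hu₂) α0.le
  clear hα hg
  subst e₁ e₂ h₁ h₂ h₃
  simp only [Int.odd_mul] at o₁ o₂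
  -- `α` divides each of `d₁, d₂, d₃`, while `d₁ + d₂ + d₃ - 2 * d₄ = 1`.
  have hcα : IsCoprime d₄ α := ⟨-2, k₁ * u₃ + k₂ * u₃ + k₂ * (k₁ * α), by linarith⟩
  have hd : d₄ ∣ u₃ * k₁ * k₂ := by
    have h1 : d₄ ∣ α * (α * (u₃ * k₁ * k₂)) := by convert ht using 1; ring
    exact hcα.dvd_of_dvd_mul_left (hcα.dvd_of_dvd_mul_left h1)
  refine ⟨α, u₃, k₁, k₂, ⟨α0, o₁.1.2⟩, ⟨hu₃, o₁.2⟩, ⟨k₁0, o₁.1.1⟩, ⟨k₂0, o₂.1.1⟩, by ring, by ring,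
    by ring, by rwa [Int.gcd_comm], ?_, hd, ?_, ?_, ?_⟩
  · have h1 : d₄ ≤ u₃ * k₁ * k₂ := Int.le_of_dvd (by positivity) hd
    have h2 : 0 < k₁ * k₂ := by positivity
    have h3 : 0 < k₁ * α * u₃ := by positivity
    have h4 : 0 < k₂ * α * u₃ := by positivity
    -- By the order relation `α²k₁k₂ = 1 + 2d₄ - αγ(k₁ + k₂)`, which is less than `2d₄ ≤ 2γk₁k₂`.
    refine lt_of_mul_lt_mul_right (a := k₁ * k₂) ?_ h2.le
    nlinarith
  · have h1 : d₄ ∣ α * (u₃ * k₁ * (α * u₃ * k₁ - 1)) := by convert q₁ using 1; ring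
    exact hcα.dvd_of_dvd_mul_left h1
  · have h1 : d₄ ∣ α * (u₃ * k₂ * (α * u₃ * k₂ - 1)) := by convert q₂ using 1; ring
    exact hcα.dvd_of_dvd_mul_left h1
  · have h1 : d₄ ∣ α * (α * (k₁ * k₂ * (α ^ 2 * k₁ * k₂ - 1))) := by convert q₃ using 1; ring
    exact hcα.dvd_of_dvd_mul_left (hcα.dvd_of_dvd_mul_left h1)

/-- `x` is a rational integer. -/
def IsInt (x : ℝ) : Prop := ∃ z : ℤ, x = z

theorem isInt_half_div {X e : ℤ} (he : e ≠ 0) (h : 2 * e ∣ X) : IsInt ((X : ℝ) / 2 / e) := by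
  obtain ⟨z, rfl⟩ := h
  have : (e : ℝ) ≠ 0 := by exact_mod_cast he
  refine ⟨z, ?_⟩
  push_cast
  field_simp

namespace IsTripleArray

variable {s : Fin 6 → Fin 6} {D : Fin 6 → ℝ} {f : Fin 6 → ℂ} {T : Fin 6 → Fin 6 → Fin 6 → ℝ}

theorem exists_arithmeticCondition (h : IsTripleArray s D f T) {t : ℝ} (hp : IsParametrized D T t)
    (hD5 : D 5 = D 4) (hint : ∀ i j k, IsInt (T i j k / D k)) :
    ∃ α γ k₁ k₂ d₁ d₂ d₃ d₄ : ℤ, ArithmeticCondition d₁ d₂ d₃ d₄ α γ k₁ k₂ ∧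
      D 1 = d₁ ∧ D 2 = d₂ ∧ D 3 = d₃ ∧ D 4 = d₄ := by
  have cyc := h.cyclic
  have p1 := h.pos 1
  have p2 := h.pos 2
  have p3 := h.pos 3
  have p4 := h.pos 4
  obtain ⟨a1, ha1⟩ := hint 4 1 1
  obtain ⟨a2, ha2⟩ := hint 4 2 2
  obtain ⟨a3, ha3⟩ := hint 4 3 3
  obtain ⟨a4, ha4⟩ := hint 4 4 5
  obtain ⟨c1, hc1⟩ := hint 4 2 1
  obtain ⟨c2, hc2⟩ := hint 4 1 2
  obtain ⟨c3, hc3⟩ := hint 4 1 3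
  obtain ⟨g1, hg1⟩ := hint 1 1 4
  obtain ⟨g2, hg2⟩ := hint 2 2 4
  obtain ⟨g3, hg3⟩ := hint 3 3 4
  obtain ⟨g4, hg4⟩ := hint 1 2 4
  obtain ⟨g5, hg5⟩ := hint 2 1 4
  rw [← cyc 4, div_eq_iff p4.ne'] at hg1 hg2 hg3 hg4 hg5
  rw [hp.e411] at hg1 ha1
  rw [hp.e422] at hg2 ha2
  rw [hp.e433] at hg3 ha3
  rw [hp.e412] at hg4 hc2
  rw [hp.e421] at hg5 hc1
  rw [hp.e413] at hc3
  rw [hD5, hp.e445] at ha4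
  have hD1 : D 1 = (2 * a1 + 1 : ℤ) := by push_cast; field_simp at ha1; linarith
  have hD2 : D 2 = (2 * a2 + 1 : ℤ) := by push_cast; field_simp at ha2; linarith
  have hD3 : D 3 = (2 * a3 + 1 : ℤ) := by push_cast; field_simp at ha3; linarith
  have hD4 : D 4 = (2 * a4 + 1 : ℤ) := by push_cast; field_simp at ha4; linarith
  obtain ⟨d1, hd1⟩ : ∃ d, d = 2 * a1 + 1 := ⟨_, rfl⟩
  obtain ⟨d2, hd2⟩ : ∃ d, d = 2 * a2 + 1 := ⟨_, rfl⟩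
  obtain ⟨d3, hd3⟩ : ∃ d, d = 2 * a3 + 1 := ⟨_, rfl⟩
  obtain ⟨d4, hd4⟩ : ∃ d, d = 2 * a4 + 1 := ⟨_, rfl⟩
  rw [← hd1] at hD1
  rw [← hd2] at hD2
  rw [← hd3] at hD3
  rw [← hd4] at hD4
  -- `T 4 2 1 / D 1 = (D 2 - t / D 1) / 2` is the integer `c1`, so `t / D 1` is an integer; likewise
  -- for `D 2` and `D 3`.
  have ht1 : t = ((d2 - 2 * c1 : ℤ) : ℝ) * D 1 := by
    rw [div_eq_iff p1.ne'] at hc1; push_cast; rw [← hD2]; linarith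
  have ht2 : t = ((2 * c2 - d1 : ℤ) : ℝ) * D 2 := by
    rw [div_eq_iff p2.ne'] at hc2; push_cast; rw [← hD1]; linarith
  have ht3 : t = ((d1 - 2 * c3 : ℤ) : ℝ) * D 3 := by
    rw [div_eq_iff p3.ne'] at hc3; push_cast; rw [← hD1]; linarith
  obtain ⟨u1, hu1⟩ : ∃ u, u = d2 - 2 * c1 := ⟨_, rfl⟩
  obtain ⟨u2, hu2⟩ : ∃ u, u = 2 * c2 - d1 := ⟨_, rfl⟩
  obtain ⟨u3, hu3⟩ : ∃ u, u = d1 - 2 * c3 := ⟨_, rfl⟩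
  rw [← hu1] at ht1
  rw [← hu2] at ht2
  rw [← hu3] at ht3
  have hsq := hp.sq
  have m1 : (u2 : ℝ) * u3 = D 1 := by
    refine mul_right_cancel₀ (mul_ne_zero p2.ne' p3.ne') ?_
    calc (u2 : ℝ) * u3 * (D 2 * D 3) = (u2 * D 2) * (u3 * D 3) := by ring
      _ = t ^ 2 := by rw [← ht2, ← ht3, sq]
      _ = _ := by rw [hsq]; ring
  have m2 : (u1 : ℝ) * u3 = D 2 := by
    refine mul_right_cancel₀ (mul_ne_zero p1.ne' p3.ne') ?_
    calc (u1 : ℝ) * u3 * (D 1 * D 3) = (u1 * D 1) * (u3 * D 3) := by ring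
      _ = t ^ 2 := by rw [← ht1, ← ht3, sq]
      _ = _ := by rw [hsq]; ring
  have m3 : (u1 : ℝ) * u2 = D 3 := by
    refine mul_right_cancel₀ (mul_ne_zero p1.ne' p2.ne') ?_
    calc (u1 : ℝ) * u2 * (D 1 * D 2) = (u1 * D 1) * (u2 * D 2) := by ring
      _ = t ^ 2 := by rw [← ht1, ← ht2, sq]
      _ = _ := by rw [hsq]; ring
  have order := hp.order
  rw [hD1, hD2, hD3, hD4] at order
  rw [hD1] at m1 p1
  rw [hD2] at m2 p2
  rw [hD3] at m3 p3
  -- `t = T 4 1 2 - T 4 2 1`, and both terms are integer multiples of `D 4`.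
  have ht4 : t = (g4 - g5) * D 4 := by linarith
  rw [hD1, ht4, hD4] at ht1
  rw [hD1, hD4] at hg1
  rw [hD2, hD4] at hg2
  rw [hD3, hD4] at hg3
  obtain ⟨α, γ, k1, k2, hA⟩ := RealityBased.exists_arithmeticCondition (d₁ := d1) (d₂ := d2)
    (d₃ := d3) (d₄ := d4) (u₁ := u1) (u₂ := u2) (u₃ := u3) ⟨a1, hd1⟩ ⟨a2, hd2⟩
    (by exact_mod_cast p1) (by exact_mod_cast p2) (by exact_mod_cast p3) (by exact_mod_cast m1)
    (by exact_mod_cast m2) (by exact_mod_cast m3) (by exact_mod_cast order)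
    ⟨g4 - g5, by have := ht1.symm; rw [mul_comm d4]; exact_mod_cast this⟩
    ⟨2 * g1, by
      have : (d1 : ℝ) * (d1 - 1) = d4 * (2 * g1) := by linarith
      exact_mod_cast this⟩
    ⟨2 * g2, by
      have : (d2 : ℝ) * (d2 - 1) = d4 * (2 * g2) := by linarith
      exact_mod_cast this⟩
    ⟨2 * g3, by
      have : (d3 : ℝ) * (d3 - 1) = d4 * (2 * g3) := by linarith
      exact_mod_cast this⟩
  exact ⟨α, γ, k1, k2, d1, d2, d3, d4, hA, hD1, hD2, hD3, hD4⟩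

end IsTripleArray

/-! ### The arithmetic condition implies integrality. -/

/-- A kernel index can be rotated to the front, and the star trades 5 for 4. -/
theorem forall_of_cyclic_of_star {P : Fin 6 → Fin 6 → Fin 6 → Prop} {s : Fin 6 → Fin 6}
    (cyc : ∀ i j k, P i j k → P j k i) (star : ∀ i j k, P i j k → P (s k) (s j) (s i))
    (inv : Function.Involutive s) (s4 : s 4 = 5)
    (h0 : ∀ i j, P 0 i j) (h4 : ∀ i j, i ≠ 0 → j ≠ 0 → P 4 i j)
    (hodd : ∀ i j k, (i = 1 ∨ i = 2 ∨ i = 3) → (j = 1 ∨ j = 2 ∨ j = 3) → (k = 1 ∨ k = 2 ∨ k = 3) →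
      P i j k) (i j k : Fin 6) : P i j k := by
  have h4' : ∀ i j, P 4 i j := fun i j => by
    by_cases hi : i = 0
    · rw [hi]; exact cyc _ _ _ (cyc _ _ _ (h0 j 4))
    · by_cases hj : j = 0
      · rw [hj]; exact cyc _ _ _ (h0 4 i)
      · exact h4 i j hi hj
  have h5 : ∀ i j, P 5 i j := fun i j => by
    have h := star _ _ _ (cyc _ _ _ (h4' (s j) (s i)))
    rwa [s4, inv, inv] at h
  have hmem : ∀ i : Fin 6, (i = 0 ∨ i = 4 ∨ i = 5) ∨ (i = 1 ∨ i = 2 ∨ i = 3) := by decide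
  have h : ∀ i j k, (i = 0 ∨ i = 4 ∨ i = 5) → P i j k := by
    rintro i j k (rfl | rfl | rfl)
    · exact h0 j k
    · exact h4' j k
    · exact h5 j k
  rcases hmem i with hi | hi
  · exact h i j k hi
  · rcases hmem j with hj | hj
    · exact cyc _ _ _ (cyc _ _ _ (h j k i hj))
    · rcases hmem k with hk | hk
      · exact cyc _ _ _ (h k i j hk)
      · exact hodd i j k hi hj hk

namespace IsTripleArray

variable {s : Fin 6 → Fin 6} {D : Fin 6 → ℝ} {f : Fin 6 → ℂ} {T : Fin 6 → Fin 6 → Fin 6 → ℝ}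

theorem isInt_of_arithmeticCondition (h : IsTripleArray s D f T) (s1 : s 1 = 1) (s2 : s 2 = 2)
    (s3 : s 3 = 3) {t : ℝ} (hp : IsParametrized D T t)
    {α γ k₁ k₂ d₁ d₂ d₃ d₄ : ℤ} (hA : ArithmeticCondition d₁ d₂ d₃ d₄ α γ k₁ k₂)
    (hD1 : D 1 = d₁) (hD2 : D 2 = d₂) (hD3 : D 3 = d₃) (hD4 : D 4 = d₄) (i j k : Fin 6) :
    IsInt (T i j k / D k) := by
  obtain ⟨⟨pα, oα⟩, ⟨pγ, oγ⟩, ⟨pk₁, ok₁⟩, ⟨pk₂, ok₂⟩, e₁, e₂, e₃, -, -, v, v₁, v₂, v₃⟩ := hA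
  have hD5 : D 5 = d₄ := by rw [← h.star_four, h.degree_star, hD4]
  have hDint : ∀ i, IsInt (D i) := fun i => by
    fin_cases i
    · exact ⟨1, by simpa using h.degree_zero⟩
    · exact ⟨_, hD1⟩
    · exact ⟨_, hD2⟩
    · exact ⟨_, hD3⟩
    · exact ⟨_, hD4⟩
    · exact ⟨_, hD5⟩
  have pd₄ : 0 < d₄ := by have := h.pos 4; rw [hD4] at this; exact_mod_cast this
  have od₄ : Odd d₄ := by
    obtain ⟨c, hc⟩ := v
    have : Odd (γ * k₁ * k₂) := (oγ.mul ok₁).mul ok₂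
    rw [hc] at this
    exact (Int.odd_mul.1 this).1
  have o₁ : Odd d₁ := e₁ ▸ (oα.mul oγ).mul ok₁
  have o₂ : Odd d₂ := e₂ ▸ (oα.mul oγ).mul ok₂
  have o₃ : Odd d₃ := e₃ ▸ (oα.pow.mul ok₁).mul ok₂
  have p₁ : d₁ ≠ 0 := by rw [e₁]; positivity
  have p₂ : d₂ ≠ 0 := by rw [e₂]; positivity
  have p₃ : d₃ ≠ 0 := by rw [e₃]; positivity
  -- `ε = ±1` is the sign of the square root; only its oddness matters below.
  obtain ⟨ε, hε, ht⟩ : ∃ ε : ℤ, Odd ε ∧ t = ((ε * (α ^ 2 * γ * k₁ * k₂) : ℤ) : ℝ) := by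
    have hsq := hp.sq
    rw [hD1, hD2, hD3, e₁, e₂, e₃] at hsq
    have : t ^ 2 = ((α ^ 2 * γ * k₁ * k₂ : ℤ) : ℝ) ^ 2 := by rw [hsq]; push_cast; ring
    rcases sq_eq_sq_iff_eq_or_eq_neg.1 this with e | e
    · exact ⟨1, odd_one, by rw [e, one_mul]⟩
    · exact ⟨-1, odd_neg_one, by rw [e, neg_one_mul, Int.cast_neg]⟩
  -- Asking for all three quotients makes the property stable under cyclic shifts and the star.
  let P : Fin 6 → Fin 6 → Fin 6 → Prop := fun i j k =>
    IsInt (T i j k / D i) ∧ IsInt (T i j k / D j) ∧ IsInt (T i j k / D k)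
  suffices hP : ∀ i j k, P i j k from (hP i j k).2.2
  have hzero : ∀ i j k, T i j k = 0 → P i j k := fun i j k e => by
    simp only [P, e, zero_div]
    exact ⟨⟨0, by simp⟩, ⟨0, by simp⟩, ⟨0, by simp⟩⟩
  have hmk : ∀ (i j : Fin 6) (x y X : ℤ), x ≠ 0 → y ≠ 0 → D i = x → D j = y → T 4 i j = X / 2 →
      2 * d₄ ∣ X → 2 * x ∣ X → 2 * y ∣ X → P 4 i j := by
    intro i j x y X hx hy hDi hDj hT w₁ w₂ w₃
    simp only [P, hT, hDi, hDj, hD4]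
    exact ⟨isInt_half_div pd₄.ne' w₁, isInt_half_div hx w₂, isInt_half_div hy w₃⟩
  have hself : ∀ i (x : ℤ), x ≠ 0 → Odd x → D i = x → T 4 i i = D i * (D i - 1) / 2 →
      d₄ ∣ x * (x - 1) → P 4 i i := by
    intro i x hx ox hDi hT hdvd
    have hx2 : 2 * x ∣ x * (x - 1) := by
      rw [mul_comm 2 x]
      exact mul_dvd_mul_left x (ox.sub_odd odd_one).two_dvd
    refine hmk i i x x (x * (x - 1)) hx hx hDi hDi (by rw [hT, hDi]; push_cast; ring) ?_ hx2 hx2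
    exact (Int.isCoprime_two_left.2 od₄).mul_dvd
      ((dvd_mul_right 2 x).trans hx2) hdvd
  have two_dvd : ∀ {x y : ℤ}, Odd x → Odd y → (2 : ℤ) ∣ x + y := fun hx hy => (hx.add_odd hy).two_dvd
  have two_dvd' : ∀ {x y : ℤ}, Odd x → Odd y → (2 : ℤ) ∣ x - y := fun hx hy => (hx.sub_odd hy).two_dvd
  have dv : d₄ ∣ α ^ 2 * γ * k₁ * k₂ := by
    rw [show α ^ 2 * γ * k₁ * k₂ = α ^ 2 * (γ * k₁ * k₂) by ring]
    exact dvd_mul_of_dvd_right v _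
  have w₁ : d₁ ∣ α ^ 2 * γ * k₁ * k₂ := ⟨α * k₂, by rw [e₁]; ring⟩
  have w₂ : d₂ ∣ α ^ 2 * γ * k₁ * k₂ := ⟨α * k₁, by rw [e₂]; ring⟩
  have w₃ : d₃ ∣ α ^ 2 * γ * k₁ * k₂ := ⟨γ, by rw [e₃]; ring⟩
  -- Each mixed entry is `m * (α²γk₁k₂) / 2` with `m` one of `γ ± ε`, `αk₁ ± ε`, `αk₂ ± ε`, even as
  -- a sum or difference of odd numbers; every degree divides `α²γk₁k₂`.
  have hoff : ∀ (i j : Fin 6) (x y m : ℤ), x ≠ 0 → y ≠ 0 → D i = x → D j = y → 2 ∣ m →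
      x ∣ α ^ 2 * γ * k₁ * k₂ → y ∣ α ^ 2 * γ * k₁ * k₂ →
      T 4 i j = ((m * (α ^ 2 * γ * k₁ * k₂) : ℤ) : ℝ) / 2 → P 4 i j :=
    fun i j x y m hx hy hDi hDj hm dx dy hT =>
      hmk i j x y _ hx hy hDi hDj hT (mul_dvd_mul hm dv) (mul_dvd_mul hm dx) (mul_dvd_mul hm dy)
  have f1 : f 1 = -1 := h.grade_eq_neg_one s1 (by decide) (by decide) (by decide)
  have f2 : f 2 = -1 := h.grade_eq_neg_one s2 (by decide) (by decide) (by decide)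
  have f3 : f 3 = -1 := h.grade_eq_neg_one s3 (by decide) (by decide) (by decide)
  have f4 : f 4 = 1 := (h.grade_eq_one 4).2 (by simp)
  have f5 : f 5 = 1 := (h.grade_eq_one 5).2 (by simp)
  have z : ∀ a b c, f a * f b * f c = -1 → P a b c := fun a b c e =>
    hzero a b c (h.eq_zero_of_grade_ne (by rw [e]; norm_num))
  have cyc : ∀ i j k, P i j k → P j k i := fun i j k ⟨x, y, w⟩ => by
    simp only [P, ← h.cyclic i j k]
    exact ⟨y, w, x⟩
  have star : ∀ i j k, P i j k → P (s k) (s j) (s i) := fun i j k ⟨x, y, w⟩ => by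
    simp only [P, h.star, h.degree_star]
    exact ⟨w, y, x⟩
  have p444 : P 4 4 4 := by
    have : 2 * d₄ ∣ (d₄ + 1) * d₄ := mul_dvd_mul_right (two_dvd od₄ odd_one) _
    exact hmk 4 4 d₄ d₄ _ pd₄.ne' pd₄.ne' hD4 hD4 (by rw [hp.e444, hD4]; push_cast; ring) this
      this this
  have p445 : P 4 4 5 := by
    have : 2 * d₄ ∣ (d₄ - 1) * d₄ := mul_dvd_mul_right (two_dvd' od₄ odd_one) _
    exact hmk 4 5 d₄ d₄ _ pd₄.ne' pd₄.ne' hD4 hD5 (by rw [hp.e445, hD4]; push_cast; ring) this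
      this this
  have p455 : P 4 5 5 := by
    have := star _ _ _ p445
    rwa [h.star_five, h.star_four] at this
  have oαk₁ := oα.mul ok₁
  have oαk₂ := oα.mul ok₂
  have p411 : P 4 1 1 := hself 1 d₁ p₁ o₁ hD1 hp.e411 (by
    rw [e₁]; exact (v₁.mul_left α).trans (dvd_of_eq (by ring)))
  have p422 : P 4 2 2 := hself 2 d₂ p₂ o₂ hD2 hp.e422 (by
    rw [e₂]; exact (v₂.mul_left α).trans (dvd_of_eq (by ring)))
  have p433 : P 4 3 3 := hself 3 d₃ p₃ o₃ hD3 hp.e433 (by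
    rw [e₃]; exact (v₃.mul_left (α ^ 2)).trans (dvd_of_eq (by ring)))
  have p412 : P 4 1 2 := hoff 1 2 d₁ d₂ _ p₁ p₂ hD1 hD2 (two_dvd oγ hε) w₁ w₂ (by
    rw [hp.e412, hD1, hD2, ht, e₁, e₂]; push_cast; ring)
  have p421 : P 4 2 1 := hoff 2 1 d₂ d₁ _ p₂ p₁ hD2 hD1 (two_dvd' oγ hε) w₂ w₁ (by
    rw [hp.e421, hD1, hD2, ht, e₁, e₂]; push_cast; ring)
  have p423 : P 4 2 3 := hoff 2 3 d₂ d₃ _ p₂ p₃ hD2 hD3 (two_dvd oαk₂ hε) w₂ w₃ (by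
    rw [hp.e423, hD2, hD3, ht, e₂, e₃]; push_cast; ring)
  have p432 : P 4 3 2 := hoff 3 2 d₃ d₂ _ p₃ p₂ hD3 hD2 (two_dvd' oαk₂ hε) w₃ w₂ (by
    rw [hp.e432, hD2, hD3, ht, e₂, e₃]; push_cast; ring)
  have p431 : P 4 3 1 := hoff 3 1 d₃ d₁ _ p₃ p₁ hD3 hD1 (two_dvd oαk₁ hε) w₃ w₁ (by
    rw [hp.e431, hD1, hD3, ht, e₁, e₃]; push_cast; ring)
  have p413 : P 4 1 3 := hoff 1 3 d₁ d₃ _ p₁ p₃ hD1 hD3 (two_dvd' oαk₁ hε) w₁ w₃ (by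
    rw [hp.e413, hD1, hD3, ht, e₁, e₃]; push_cast; ring)
  refine forall_of_cyclic_of_star cyc star h.involutive h.star_four (fun i j => ?_)
    (fun i j hi hj => ?_) ?_
  · by_cases hij : j = s i
    · have hT : T 0 i j = D i := by rw [h.zero_left, if_pos hij]
      have hDj : D j = D i := by rw [hij, h.degree_star]
      simp only [P, hT, hDj, h.degree_zero, div_one, div_self (h.pos i).ne']
      exact ⟨hDint i, ⟨1, by simp⟩, ⟨1, by simp⟩⟩
    · exact hzero _ _ _ (by rw [h.zero_left, if_neg hij])
  · have hmem : ∀ i : Fin 6, i ≠ 0 → i = 1 ∨ i = 2 ∨ i = 3 ∨ i = 4 ∨ i = 5 := by decide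
    rcases hmem i hi with rfl | rfl | rfl | rfl | rfl <;>
    rcases hmem j hj with rfl | rfl | rfl | rfl | rfl <;>
    first
    | assumption
    | exact cyc _ _ _ p445
    | exact z _ _ _ (by simp [f1, f2, f3, f4, f5])
  · have hf : ∀ i : Fin 6, (i = 1 ∨ i = 2 ∨ i = 3) → f i = -1 := by
      rintro i (rfl | rfl | rfl) <;> assumption
    intro i j k hi hj hk
    exact z _ _ _ (by rw [hf i hi, hf j hj, hf k hk]; norm_num)

end IsTripleArray
end RealityBased

theorem theorem6p7 {A : Type*} [Ring A] [StarRing A] [Algebra ℂ A] [StarModule ℂ A]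
    (b : Module.Basis (Fin 6) ℂ A) (δ φ : A →ₐ[ℂ] ℂ)
    (h : RealityBased.IsNonRealBipartite b δ φ) :
    RealityBased.IsIntegral b ↔
      ∃ α γ k₁ k₂ : ℤ,
        (0 < α ∧ Odd α) ∧ (0 < γ ∧ Odd γ) ∧ (0 < k₁ ∧ Odd k₁) ∧ (0 < k₂ ∧ Odd k₂) ∧
        δ (b 1) = ((α * γ * k₁ : ℤ) : ℂ) ∧
        δ (b 2) = ((α * γ * k₂ : ℤ) : ℂ) ∧
        δ (b 3) = ((α ^ 2 * k₁ * k₂ : ℤ) : ℂ) ∧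
        Int.gcd k₁ k₂ = 1 ∧
        α ^ 2 < 2 * γ ∧
        ∃ d₄ : ℤ, δ (b 4) = (d₄ : ℂ) ∧
          d₄ ∣ γ * k₁ * k₂ ∧
          d₄ ∣ γ * k₁ * (α * γ * k₁ - 1) ∧
          d₄ ∣ γ * k₂ * (α * γ * k₂ - 1) ∧
          d₄ ∣ k₁ * k₂ * (α ^ 2 * k₁ * k₂ - 1) := by
  obtain ⟨s, D, f, T, hT, hD, hc⟩ := h.exists_tripleArray
  -- Symmetry in the first two indices would make basis elements commute, hence all of `A`.
  have hns : ¬ ∀ i j k, T i j k = T j i k := fun hsymm => by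
    obtain ⟨x, y, hxy⟩ := h.noncomm
    refine hxy ?_
    have hb : ∀ i j, b i * b j = b j * b i := fun i j => by
      refine b.ext_elem fun k => ?_
      have h1 := hc i j (s k)
      have h2 := hc j i (s k)
      rw [hT.involutive] at h1 h2
      exact h1.trans ((congrArg _ (by rw [hsymm])).trans h2.symm)
    have hl : LinearMap.mul ℂ A = (LinearMap.mul ℂ A).flip :=
      b.ext fun i => b.ext fun j => by simpa using hb i j
    simpa using LinearMap.congr_fun₂ hl x y
  obtain ⟨s1, s2, s3⟩ := hT.star_eq_of_not_symm hns
  obtain ⟨t, hp⟩ := hT.exists_isParametrized s1 s2 s3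
  have hD5 : D 5 = D 4 := by rw [← hT.star_four, hT.degree_star]
  have hint : RealityBased.IsIntegral b ↔ ∀ i j k, RealityBased.IsInt (T i j k / D k) := by
    refine ⟨fun hi i j k => ?_, fun hi i j k => ?_⟩
    · obtain ⟨z, hz⟩ := hi i j (s k)
      rw [hc] at hz
      exact ⟨z, by exact_mod_cast hz⟩
    · obtain ⟨z, hz⟩ := hi i j (s k)
      have := hc i j (s k)
      rw [hT.involutive, hz] at this
      exact ⟨z, by exact_mod_cast this⟩
  rw [hint]
  have hcast : ∀ i (z : ℤ), δ (b i) = (z : ℂ) ↔ D i = z := fun i z => by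
    rw [hD]; norm_cast
  simp only [hcast]
  constructor
  · intro hi
    obtain ⟨α, γ, k₁, k₂, d₁, d₂, d₃, d₄,
      ⟨hα, hγ, hk₁, hk₂, e₁, e₂, e₃, hg, hlt, v, v₁, v₂, v₃⟩, h1, h2, h3, h4⟩ :=
      hT.exists_arithmeticCondition hp hD5 hi
    exact ⟨α, γ, k₁, k₂, hα, hγ, hk₁, hk₂, e₁ ▸ h1, e₂ ▸ h2, e₃ ▸ h3, hg, hlt, d₄, h4, v, v₁, v₂, v₃⟩
  · rintro ⟨α, γ, k₁, k₂, hα, hγ, hk₁, hk₂, h1, h2, h3, hg, hlt, d₄, h4, v, v₁, v₂, v₃⟩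
    exact hT.isInt_of_arithmeticCondition s1 s2 s3 hp
      ⟨hα, hγ, hk₁, hk₂, rfl, rfl, rfl, hg, hlt, v, v₁, v₂, v₃⟩ h1 h2 h3 h4
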